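/- Let $G$ be a finite group and let $T_{11},T_{22},T_{12},T_{21}\subseteq G$ be subsets each of which is closed under conjugation. Let $\Gamma=\mathrm{SC}(G,T_{11},T_{22},T_{12},T_{21})$ be the corresponding (quasi-abelian) semi-Cayley digraph: its vertices are two disjoint copies $\{g_1\mid g\in G\}$, $\{g_2\mid g\in G\}$ of $G$, and for $i,j\in\{1,2\}$ there is an arc from $h_i$ to $g_j$ if and only if $gh^{-1}\in T_{ij}$. The splitting field $\mathrm{SF}(\Gamma)\subseteq\mathbb{C}$ is the smallest extension of $\mathbb{Q}$ that contains all eigenvalues of the adjacency matrix of $\Gamma$, and $\deg(\Gamma)=[\mathrm{SF}(\Gamma):\mathbb{Q}]$. For multisets $X,Y$ of elements of $G$, put $XY=[xy\mid x\in X,\,y\in Y]$ and $X^t=[x^t\mid x\in X]$; let $X\cup Y$ be the union with multiplicities added, $k*X$ the multiset with all multiplicities of $X$ multiplied by $k$, and $X\setminus Y$ the multiset in which $x$ has multiplicity $\max(a_x-b_x,0)$, where $a_x,b_x$ are the multiplicities of $x$ in $X,Y$. Define $$I_1=T_{11}\cup T_{22},\qquad I_2=(T_{11}T_{11})\cup(T_{22}T_{22})\cup(4*T_{12}T_{21}),\qquad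 I_3=2*T_{11}T_{22}.$$ Let $\mathrm{Irr}(G)$ be the set of irreducible complex characters of $G$. For $\chi\in\mathrm{Irr}(G)$ and a multiset $A$ of elements of $G$ put $d_\chi=\chi(1)$, $\chi(A)=\sum_{a\in A}\chi(a)$ (with multiplicity), and $$\delta_\chi=d_\chi\bigl(\chi(I_2\setminus I_3)-\chi(I_3\setminus I_2)\bigr).$$ Let $\sqrt{\delta_\chi}$ denote an arbitrarily chosen complex square root of $\delta_\chi$. Let $m$ be the exponent of $G$, let $\omega_m\in\mathbb{C}$ be a primitive $m$-th root of unity, and let $\eta:\mathrm{Gal}(\mathbb{Q}(\omega_m)/\mathbb{Q})\to\mathbb{Z}_m^*$ be the isomorphism with $\sigma(\omega_m)=\omega_m^{\eta(\sigma)}$. Put $$T=\{t\in\mathbb{Z}_m^*\mid I_1^t=I_1,\ (I_2\setminus I_3)^t=I_2\setminus I_3,\ (I_3\setminus I_2)^t=I_3\setminus I_2\},$$ $$K=\mathbb{Q}\bigl(\chi(I_1),\ \chi(I_2\setminus I_3)-\chi(I_3\setminus I_2)\mid\chi\in\mathrm{Irr}(G)\bigr).$$ Then $$K=\{x\in\mathbb{Q}(\omega_m)\mid\sigma(x)=x\text{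 for all }\sigma\in\eta^{-1}(T)\},$$ $$\mathrm{SF}(\Gamma)=\mathbb{Q}\bigl(\chi(I_1),\sqrt{\delta_\chi}\mid\chi\in\mathrm{Irr}(G)\bigr)=K\bigl(\sqrt{\delta_\chi}\mid\chi\in\mathrm{Irr}(G)\bigr).$$ Moreover, every $\delta_\chi$ lies in $K$, and $$\deg(\Gamma)=\frac{\varphi(m)\,|M|}{|T|},$$ where $\varphi$ is Euler's function and $M$ is the subgroup of $K^\times/K^{\times2}$, with $K^{\times 2}=\{k^2\mid k\in K^\times\}$, generated by the classes of those $\delta_\chi$, $\chi\in\mathrm{Irr}(G)$, that are nonzero. -/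

import Mathlib

open IntermediateField

noncomputable section

namespace SemiCayley

section Groups

variable {G : Type*} [Group G]

/-- A subset of a group that is closed under conjugation, i.e. a union of conjugacy classes. -/
def ConjClosed (S : Finset G) : Prop :=
  ∀ s ∈ S, ∀ g : G, g⁻¹ * s * g ∈ S

/-- The multiset `XY = [xy | x ∈ X, y ∈ Y]`. -/
def mulMultiset (X Y : Multiset G) : Multiset G :=
  (X ×ˢ Y).map fun p => p.1 * p.2

/-- The multiset `X ^ t = [x ^ t | x ∈ X]` for a residue `t` modulo the exponent of the group. -/
def powMultiset (X : Multiset G) (t : (ZMod (Monoid.exponent G))ˣ) : Multiset G :=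
  X.map fun x => x ^ (t : ZMod (Monoid.exponent G)).val

/-- The set `Irr(G)` of the irreducible complex characters of `G`. -/
def Irr (G : Type*) [Group G] : Set (G → ℂ) :=
  {χ | ∃ (V : Type) (_ : AddCommGroup V) (_ : Module ℂ V) (_ : FiniteDimensional ℂ V)
    (ρ : Representation ℂ G V), ρ.IsIrreducible ∧ χ = ρ.character}

/-- `χ(A) = ∑ a ∈ A, χ(a)`, summed with multiplicity. -/
def charSum (χ : G → ℂ) (A : Multiset G) : ℂ :=
  (A.map χ).sum

/-- The semi-Cayley digraph `SC(G, T₁₁, T₂₂, T₁₂, T₂₁)`; `Sum.inl g` and `Sum.inr g` are the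
vertices `g₁` and `g₂`. -/
def graph (T11 T22 T12 T21 : Finset G) : Digraph (G ⊕ G) where
  Adj
    | Sum.inl h, Sum.inl g => g * h⁻¹ ∈ T11
    | Sum.inr h, Sum.inr g => g * h⁻¹ ∈ T22
    | Sum.inl h, Sum.inr g => g * h⁻¹ ∈ T12
    | Sum.inr h, Sum.inl g => g * h⁻¹ ∈ T21

/-- `SC(G, T₁₁, T₂₂, T₁₂, T₂₁)` is quasi-abelian. -/
def IsQuasiAbelian (T11 T22 T12 T21 : Finset G) : Prop :=
  ConjClosed T11 ∧ ConjClosed T22 ∧ ConjClosed T12 ∧ ConjClosed T21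

/-- The multiset `I₁ = T₁₁ ∪ T₂₂` (unions of multisets add multiplicities). -/
def I1 (T11 T22 : Finset G) : Multiset G :=
  T11.val + T22.val

/-- The multiset `I₂ = T₁₁T₁₁ ∪ T₂₂T₂₂ ∪ 4 * T₁₂T₂₁`. -/
def I2 (T11 T22 T12 T21 : Finset G) : Multiset G :=
  mulMultiset T11.val T11.val + mulMultiset T22.val T22.val + 4 • mulMultiset T12.val T21.val

/-- The multiset `I₃ = 2 * T₁₁T₂₂`. -/
def I3 (T11 T22 : Finset G) : Multiset G :=
  2 • mulMultiset T11.val T22.val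

variable [DecidableEq G]

/-- `χ(I₂ ∖ I₃) - χ(I₃ ∖ I₂)`; subtraction of multisets truncates multiplicities at zero. -/
def charDiff (T11 T22 T12 T21 : Finset G) (χ : G → ℂ) : ℂ :=
  charSum χ (I2 T11 T22 T12 T21 - I3 T11 T22) - charSum χ (I3 T11 T22 - I2 T11 T22 T12 T21)

/-- The radicand `d_χ (χ(I₂ ∖ I₃) - χ(I₃ ∖ I₂))`, where `d_χ = χ(1)`. -/
def radicand (T11 T22 T12 T21 : Finset G) (χ : G → ℂ) : ℂ :=
  χ 1 * charDiff T11 T22 T12 T21 χ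

/-- `T = {t ∈ ℤ_m^* | I₁^t = I₁, (I₂ ∖ I₃)^t = I₂ ∖ I₃, (I₃ ∖ I₂)^t = I₃ ∖ I₂}`, where `m` is the
exponent of the group. -/
def stabilizer (T11 T22 T12 T21 : Finset G) : Set (ZMod (Monoid.exponent G))ˣ :=
  {t | powMultiset (I1 T11 T22) t = I1 T11 T22 ∧
    powMultiset (I2 T11 T22 T12 T21 - I3 T11 T22) t = I2 T11 T22 T12 T21 - I3 T11 T22 ∧
    powMultiset (I3 T11 T22 - I2 T11 T22 T12 T21) t = I3 T11 T22 - I2 T11 T22 T12 T21}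

/-- `K = ℚ(χ(I₁), χ(I₂ ∖ I₃) - χ(I₃ ∖ I₂) | χ ∈ Irr(G))`. -/
def baseField (T11 T22 T12 T21 : Finset G) : IntermediateField ℚ ℂ :=
  adjoin ℚ ((fun χ : G → ℂ => charSum χ (I1 T11 T22)) '' Irr G ∪
    charDiff T11 T22 T12 T21 '' Irr G)

end Groups

section Digraphs

variable {V : Type*} [Fintype V] [DecidableEq V]

open Classical in
/-- The adjacency matrix of a finite digraph, with complex entries. -/
def adjacencyMatrix (Γ : Digraph V) : Matrix V V ℂ :=
  Matrix.of fun v w => if Γ.Adj v w then 1 else 0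

/-- The splitting field of a finite digraph: the smallest subfield of `ℂ` that contains all
eigenvalues of the adjacency matrix. -/
def splittingField (Γ : Digraph V) : IntermediateField ℚ ℂ :=
  adjoin ℚ {z : ℂ | (adjacencyMatrix Γ).charpoly.IsRoot z}

/-- The algebraic degree of a finite digraph. -/
def algebraicDegree (Γ : Digraph V) : ℕ :=
  Module.finrank ℚ (splittingField Γ)

end Digraphs

section Fields

/-- The generator of `ℚ(ω)` is a primitive `m`-th root of unity if `ω` is. -/
theorem isPrimitiveRoot_gen {m : ℕ} {ω : ℂ} (hω : IsPrimitiveRoot ω m) :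
    IsPrimitiveRoot (AdjoinSimple.gen ℚ ω) m := by
  refine IsPrimitiveRoot.of_map_of_injective (f := (ℚ⟮ω⟯).val) ?_ (ℚ⟮ω⟯).val.injective
  simpa using hω

/-- The homomorphism `η : Gal(ℚ(ω)/ℚ) → ℤ_m^*` with `σ(ω) = ω ^ η(σ)`. -/
def eta {m : ℕ} [NeZero m] {ω : ℂ} (hω : IsPrimitiveRoot ω m) :
    (ℚ⟮ω⟯ ≃ₐ[ℚ] ℚ⟮ω⟯) →* (ZMod m)ˣ :=
  (isPrimitiveRoot_gen hω).autToPow ℚ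

/-- The subgroup of `K^× / K^{×2}` generated by the classes of the nonzero elements of `K` that
belong to `R`. -/
def squareClassGroup (K : IntermediateField ℚ ℂ) (R : Set ℂ) :
    Subgroup (Kˣ ⧸ (powMonoidHom 2 : Kˣ →* Kˣ).range) :=
  Subgroup.closure {q | ∃ u : Kˣ, ((u : K) : ℂ) ∈ R ∧ QuotientGroup.mk u = q}

end Fields

end SemiCayley

end

/-!
Work in the group ring `ℂ[G]`, acting on itself by left multiplication. The transposed adjacency
matrix of `Γ` has the four blocks of the multiplications by the sums of `T₁₁`, `T₂₁`, `T₁₂`, `T₂₂`,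
which are central because the `T_ij` are closed under conjugation. Hence `z` is an eigenvalue of `Γ`
if and only if the central element `(z - T₁₁)(z - T₂₂) - T₂₁T₁₂` is not a unit. By Schur's lemma a
central element acts as a scalar on every irreducible module, and it is a unit if and only if none
of these scalars vanishes; so the eigenvalues are the roots of one quadratic polynomial for each
`χ ∈ Irr(G)`, with discriminant `δ_χ / d_χ ^ 2`.

Since `χ(g)` is a sum of `m`-th roots of unity, `σ` maps `χ(A)` to `χ(A ^ η(σ))`. A
conjugation-invariant multiset is determined by its character sums, because its sum in the
semisimple ring `ℂ[G]` is central. Therefore `σ` fixes `K` exactly if `η(σ) ∈ T`, and the Galois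
correspondence gives `K` and `[K : ℚ]`.

Finally choose for every class in `M` a square root. These roots span `K(√δ_χ)` over `K`, and they
are eigenvectors of the Galois group with pairwise distinct characters, hence linearly independent.
-/

namespace SemiCayley

section GroupRing

open MonoidAlgebra

variable {k G : Type*} [CommSemiring k]

/-- The sum of the members of a multiset of group elements, formed in the group ring; it turns
products of multisets into products in the group ring and conjugation-invariant multisets into
central elements. -/
noncomputable def groupRingSum (k : Type*) [CommSemiring k] [Monoid G] (A : Multiset G) : k[G] :=
  (A.map (of k G)).sum

section Monoid

variable [Monoid G]

theorem groupRingSum_cons (a : G) (A : Multiset G) :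
    groupRingSum k (a ::ₘ A) = of k G a + groupRingSum k A := by
  simp only [groupRingSum, Multiset.map_cons, Multiset.sum_cons]

theorem coeff_groupRingSum [DecidableEq G] (A : Multiset G) (g : G) :
    (groupRingSum k A).coeff g = A.count g := by
  induction A using Multiset.induction with
  | empty => simp [groupRingSum]
  | cons a A ih =>
    simp [groupRingSum_cons, ih, Multiset.count_cons, Finsupp.single_apply, eq_comm, add_comm]

theorem groupRingSum_injective [CharZero k] :
    Function.Injective (groupRingSum k : Multiset G → k[G]) := by
  classical
  intro A B h
  ext g
  have hg := congrArg (fun c => c.coeff g) h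
  simpa only [coeff_groupRingSum, Nat.cast_inj] using hg

theorem mem_center_monoidAlgebra_iff {c : k[G]} :
    c ∈ Subalgebra.center k k[G] ↔ ∀ g, of k G g * c = c * of k G g := by
  refine Subalgebra.mem_center_iff.trans ⟨fun h g => h _, fun h b => ?_⟩
  induction b using MonoidAlgebra.induction_linear with
  | zero => rw [zero_mul, mul_zero]
  | add x y hx hy => rw [add_mul, mul_add, hx, hy]
  | single g a => rw [← smul_of, smul_mul_assoc, mul_smul_comm, h]

/-- Linear extension of a function on the group to the group ring, used to evaluate characters at
group ring elements. -/
noncomputable def linearExtension (χ : G → k) : k[G] →ₗ[k] k :=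
  Finsupp.linearCombination k χ ∘ₗ (coeffLinearEquiv k).toLinearMap

theorem linearExtension_of (χ : G → k) (g : G) : linearExtension χ (of k G g) = χ g := by
  simp [linearExtension, coeffLinearEquiv]

theorem linearExtension_groupRingSum (χ : G → ℂ) (A : Multiset G) :
    linearExtension χ (groupRingSum ℂ A) = charSum χ A := by
  simp only [groupRingSum, charSum, map_multiset_sum, Multiset.map_map, Function.comp_def,
    linearExtension_of]

theorem linearExtension_character {V : Type*} [AddCommGroup V] [Module ℂ V]
    (ρ : Representation ℂ G V) (c : ℂ[G]) :
    linearExtension ρ.character c = LinearMap.trace ℂ V (ρ.asAlgebraHom c) := by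
  induction c using MonoidAlgebra.induction_linear with
  | zero => simp only [map_zero]
  | add x y hx hy => simp only [map_add, hx, hy]
  | single g a =>
    rw [← smul_of, map_smul, linearExtension_of, map_smul, ρ.asAlgebraHom_of, map_smul]
    rfl

end Monoid

section Group

variable [Group G]

theorem groupRingSum_mulMultiset (A B : Multiset G) :
    groupRingSum k (mulMultiset A B) = groupRingSum k A * groupRingSum k B := by
  simp only [groupRingSum, mulMultiset, SProd.sprod, Multiset.product, Multiset.map_bind,
    Multiset.map_map, Multiset.sum_bind, Function.comp_def, map_mul, Multiset.sum_map_mul_left,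
    Multiset.sum_map_mul_right]

theorem of_mul_groupRingSum_mul_of_inv (g : G) (A : Multiset G) :
    of k G g * groupRingSum k A * of k G g⁻¹ = groupRingSum k (A.map (MulAut.conj g)) := by
  simp only [groupRingSum, Multiset.map_map, Function.comp_def, MulAut.conj_apply, map_mul,
    Multiset.sum_map_mul_left, Multiset.sum_map_mul_right]

theorem of_mul_eq_mul_of_iff (g : G) (c d : k[G]) :
    of k G g * c = d * of k G g ↔ of k G g * c * of k G g⁻¹ = d := by
  have hinv : of k G g * of k G g⁻¹ = 1 ∧ of k G g⁻¹ * of k G g = 1 := by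
    simp only [← map_mul, mul_inv_cancel, inv_mul_cancel, map_one, and_self]
  constructor <;> intro h
  · rw [h, mul_assoc, hinv.1, mul_one]
  · rw [← h, mul_assoc, hinv.2, mul_one]

/-- Conjugation-invariant multisets of group elements, the multiset version of `ConjClosed`; unlike
subsets they are closed under sums and products. -/
def IsClassMultiset (A : Multiset G) : Prop :=
  ∀ g, A.map (MulAut.conj g) = A

theorem groupRingSum_mem_center_iff [CharZero k] {A : Multiset G} :
    groupRingSum k A ∈ Subalgebra.center k k[G] ↔ IsClassMultiset A := by
  simp only [mem_center_monoidAlgebra_iff, IsClassMultiset, of_mul_eq_mul_of_iff,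
    of_mul_groupRingSum_mul_of_inv, groupRingSum_injective.eq_iff]

namespace IsClassMultiset

variable {A B : Multiset G}

theorem add (hA : IsClassMultiset A) (hB : IsClassMultiset B) : IsClassMultiset (A + B) :=
  fun g => by rw [Multiset.map_add, hA, hB]

theorem nsmul (hA : IsClassMultiset A) (n : ℕ) : IsClassMultiset (n • A) :=
  fun g => by rw [Multiset.map_nsmul, hA]

theorem mul (hA : IsClassMultiset A) (hB : IsClassMultiset B) :
    IsClassMultiset (mulMultiset A B) := by
  rw [← groupRingSum_mem_center_iff (k := ℚ)] at *
  rw [groupRingSum_mulMultiset]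
  exact mul_mem hA hB

theorem powMultiset (hA : IsClassMultiset A) (t : (ZMod (Monoid.exponent G))ˣ) :
    IsClassMultiset (powMultiset A t) := fun g => by
  conv_rhs => rw [← hA g]
  simp only [SemiCayley.powMultiset, Multiset.map_map, Function.comp_def, map_pow]

end IsClassMultiset

theorem ConjClosed.isClassMultiset {S : Finset G} (hS : ConjClosed S) :
    IsClassMultiset S.val := fun g => by
  have hle : S.map (MulAut.conj g).toEmbedding ≤ S := by
    intro x hx
    obtain ⟨s, hs, rfl⟩ := Finset.mem_map.mp hx
    simpa using hS s hs g⁻¹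
  have heq := Finset.eq_of_subset_of_card_le hle (Finset.card_map _).ge
  exact congrArg Finset.val heq

end Group

end GroupRing

section Schur

open MonoidAlgebra

variable {k G : Type*} [Field k] [Monoid G]

theorem exists_asAlgebraHom_eq_algebraMap [IsAlgClosed k] {V : Type*} [AddCommGroup V] [Module k V]
    [FiniteDimensional k V] (ρ : Representation k G V) (hρ : ρ.IsIrreducible) {c : k[G]}
    (hc : c ∈ Subalgebra.center k k[G]) :
    ∃ a, ρ.asAlgebraHom c = algebraMap k (Module.End k V) a := by
  let f : Representation.IntertwiningMap ρ ρ := ⟨ρ.asAlgebraHom c, fun g => by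
    have h := congrArg ρ.asAlgebraHom (mem_center_monoidAlgebra_iff.mp hc g)
    simp only [map_mul, ρ.asAlgebraHom_of] at h
    exact h.symm⟩
  obtain ⟨a, ha⟩ :=
    Representation.IsIrreducible.algebraMap_intertwiningMap_bijective_of_isAlgClosed.2 f
  exact ⟨a, (congrArg Representation.IntertwiningMap.toLinearMap ha).symm⟩

theorem exists_asModule_linearEquiv (M : Type*) [AddCommGroup M] [Module k M] [Module k[G] M]
    [IsScalarTower k k[G] M] [FiniteDimensional k M] :
    ∃ (n : ℕ) (ρ : Representation k G (Fin n → k)), Nonempty (M ≃ₗ[k[G]] ρ.asModule) := by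
  let e := (Module.finBasis k M).equivFun
  let φ : k[G] →ₐ[k] Module.End k _ := (e.conjAlgEquiv k).toAlgHom.comp (Algebra.lsmul k k M)
  refine ⟨_, (lift k _ G).symm φ, ⟨{ e with map_smul' := fun c x => ?_ }⟩⟩
  let ρ : Representation k G _ := (lift k _ G).symm φ
  have hρ : ρ.asAlgebraHom = φ := (lift k _ G).apply_symm_apply φ
  change e (c • x) = ρ.asAlgebraHom c (e x)
  rw [hρ]
  simp [φ]

end Schur

section Irreducible

open MonoidAlgebra

variable {G : Type*} [Group G] {χ : G → ℂ} {c : ℂ[G]}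

theorem Irr.exists_natCast_eq_one (hχ : χ ∈ Irr G) : ∃ d : ℕ, d ≠ 0 ∧ χ 1 = d := by
  obtain ⟨V, _, _, _, ρ, hρ, rfl⟩ := hχ
  have hnontriv : Nontrivial V := IsSimpleModule.nontrivial ℂ[G] ρ.asModule
  exact ⟨Module.finrank ℂ V, Module.finrank_pos.ne', ρ.char_one⟩

theorem Irr.one_ne_zero (hχ : χ ∈ Irr G) : χ 1 ≠ 0 := by
  obtain ⟨d, hd, h⟩ := Irr.exists_natCast_eq_one hχ
  exact h ▸ Nat.cast_ne_zero.mpr hd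

theorem Irr.one_mul_linearExtension_mul (hχ : χ ∈ Irr G)
    (hc : c ∈ Subalgebra.center ℂ ℂ[G]) (d : ℂ[G]) :
    χ 1 * linearExtension χ (c * d) = linearExtension χ c * linearExtension χ d := by
  obtain ⟨V, _, _, _, ρ, hρ, rfl⟩ := hχ
  obtain ⟨a, ha⟩ := exists_asAlgebraHom_eq_algebraMap ρ hρ hc
  simp only [linearExtension_character, map_mul, ha, Algebra.algebraMap_eq_smul_one,
    smul_mul_assoc, one_mul, map_smul, LinearMap.trace_one, ρ.char_one, smul_eq_mul]
  ring

theorem Irr.one_mul_charSum_mulMultiset (hχ : χ ∈ Irr G) {A : Multiset G}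
    (hA : IsClassMultiset A) (B : Multiset G) :
    χ 1 * charSum χ (mulMultiset A B) = charSum χ A * charSum χ B := by
  simp only [← linearExtension_groupRingSum, groupRingSum_mulMultiset]
  exact Irr.one_mul_linearExtension_mul hχ (groupRingSum_mem_center_iff.mpr hA) _

variable [Finite G]

theorem exists_irr_mem_iff_linearExtension_eq_zero (I : Ideal ℂ[G]) [hI : I.IsMaximal] :
    ∃ χ ∈ Irr G, ∀ c ∈ Subalgebra.center ℂ ℂ[G], c ∈ I ↔ linearExtension χ c = 0 := by
  have hfin : FiniteDimensional ℂ ℂ[G] := .equiv (coeffLinearEquiv ℂ).symm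
  have hsimple : IsSimpleModule ℂ[G] (ℂ[G] ⧸ I) := isSimpleModule_iff_isCoatom.mpr hI.out
  obtain ⟨n, ρ, ⟨e⟩⟩ := exists_asModule_linearEquiv (k := ℂ) (G := G) (ℂ[G] ⧸ I)
  have hρ : ρ.IsIrreducible := ρ.irreducible_iff_isSimpleModule_asModule.mpr (.congr e.symm)
  have hχ : ρ.character ∈ Irr G := ⟨_, _, _, inferInstance, ρ, hρ, rfl⟩
  refine ⟨ρ.character, hχ, fun c hc => ?_⟩
  obtain ⟨a, ha⟩ := exists_asAlgebraHom_eq_algebraMap ρ hρ hc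
  let v : Fin n → ℂ := e (Submodule.Quotient.mk 1)
  have hv : v ≠ 0 := fun h => hI.ne_top <| (Ideal.eq_top_iff_one I).mpr <|
    (Submodule.Quotient.mk_eq_zero I).mp (e.map_eq_zero_iff.mp h)
  have hcv : e (Submodule.Quotient.mk c) = a • v := by
    rw [← mul_one c, ← smul_eq_mul, Submodule.Quotient.mk_smul, e.map_smul]
    change ρ.asAlgebraHom c v = a • v
    rw [ha, Module.algebraMap_end_apply]
  have htrace : linearExtension ρ.character c = a * ρ.character 1 := by
    rw [linearExtension_character, ha, Algebra.algebraMap_eq_smul_one, map_smul,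
      LinearMap.trace_one, smul_eq_mul, ρ.char_one]
  rw [htrace, mul_eq_zero_iff_right (Irr.one_ne_zero hχ), ← Submodule.Quotient.mk_eq_zero,
    ← e.map_eq_zero_iff, hcv]
  exact smul_eq_zero_iff_left hv

theorem isUnit_iff_forall_irr_linearExtension_ne_zero (hc : c ∈ Subalgebra.center ℂ ℂ[G]) :
    IsUnit c ↔ ∀ χ ∈ Irr G, linearExtension χ c ≠ 0 := by
  refine ⟨fun ⟨u, hu⟩ χ hχ h0 => ?_, fun h => ?_⟩
  · have h := Irr.one_mul_linearExtension_mul hχ hc ↑u⁻¹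
    rw [← hu, u.mul_inv, hu, h0, zero_mul] at h
    have hone : linearExtension χ 1 = χ 1 := linearExtension_of χ 1
    rw [hone] at h
    exact mul_self_ne_zero.mpr (Irr.one_ne_zero hχ) h
  · by_contra hunit
    obtain ⟨I, hI, hcI⟩ := Ideal.exists_le_maximal (Ideal.span {c}) fun htop => hunit <| by
      obtain ⟨d, hd⟩ := Ideal.mem_span_singleton'.mp ((Ideal.eq_top_iff_one _).mp htop)
      exact ⟨⟨c, d, (Subalgebra.mem_center_iff.mp hc d).symm.trans hd, hd⟩, rfl⟩
    obtain ⟨χ, hχ, hmem⟩ := exists_irr_mem_iff_linearExtension_eq_zero I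
    exact h χ hχ ((hmem c hc).mp (hcI (Ideal.mem_span_singleton_self c)))

theorem eq_zero_of_forall_irr_linearExtension_eq_zero (hc : c ∈ Subalgebra.center ℂ ℂ[G])
    (h : ∀ χ ∈ Irr G, linearExtension χ c = 0) : c = 0 := by
  have : NeZero (Nat.card G : ℂ) := ⟨Nat.cast_ne_zero.mpr Nat.card_pos.ne'⟩
  rw [← Ideal.mem_bot, ← IsSemisimpleRing.jacobson_eq_bot, Ring.jacobson_eq_sInf_isMaximal,
    Ideal.mem_sInf]
  intro I hI
  have : I.IsMaximal := hI
  obtain ⟨χ, hχ, hmem⟩ := exists_irr_mem_iff_linearExtension_eq_zero I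
  exact (hmem c hc).mpr (h χ hχ)

theorem IsClassMultiset.eq_iff_forall_irr_charSum_eq {A B : Multiset G} (hA : IsClassMultiset A)
    (hB : IsClassMultiset B) : A = B ↔ ∀ χ ∈ Irr G, charSum χ A = charSum χ B := by
  refine ⟨fun h χ _ => h ▸ rfl, fun h => groupRingSum_injective (k := ℂ) (sub_eq_zero.mp ?_)⟩
  refine eq_zero_of_forall_irr_linearExtension_eq_zero (sub_mem
    (groupRingSum_mem_center_iff.mpr hA) (groupRingSum_mem_center_iff.mpr hB)) fun χ hχ => ?_
  rw [map_sub, linearExtension_groupRingSum, linearExtension_groupRingSum, h χ hχ, sub_self]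

end Irreducible

section BlockMatrices

variable {R S n : Type*} [CommRing R] [CommRing S] [Fintype n] [DecidableEq n]

theorem det_fromBlocks_map (f : S →+* Matrix n n R) (a b c d : S) :
    (Matrix.fromBlocks (f a) (f b) (f c) (f d)).det = (f (a * d - b * c)).det := by
  rw [← Matrix.det_fin_two_of, Matrix.det_det,
    ← Matrix.det_reindex_self ((Equiv.boolProdEquivSum n).symm.trans
      (finTwoEquiv.symm.prodCongr (Equiv.refl n)))]
  congr 1
  ext ⟨i, g⟩ ⟨j, h⟩
  fin_cases i <;> fin_cases j <;> rfl

theorem eval_charpoly_fromBlocks_map [Algebra R S] (L : S →ₐ[R] Matrix n n R) (a b c d : S)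
    (z : R) : (Matrix.fromBlocks (L a) (L b) (L c) (L d)).charpoly.eval z =
      (L ((algebraMap R S z - a) * (algebraMap R S z - d) - b * c)).det := by
  have hz : Matrix.scalar n z = L (algebraMap R S z) := (L.commutes z).symm
  have hblocks : Matrix.scalar (n ⊕ n) z - Matrix.fromBlocks (L a) (L b) (L c) (L d) =
      Matrix.fromBlocks (L (algebraMap R S z - a)) (L (-b)) (L (-c))
        (L (algebraMap R S z - d)) := by
    rw [map_sub, map_sub, map_neg, map_neg, ← hz, sub_eq_add_neg, Matrix.fromBlocks_neg]
    ext (i | i) (j | j) <;> simp [Matrix.diagonal_apply, sub_eq_add_neg]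
  rw [Matrix.eval_charpoly, hblocks, ← neg_mul_neg b c]
  exact det_fromBlocks_map L.toRingHom _ _ _ _

end BlockMatrices

section RegularRepresentation

open MonoidAlgebra

variable {k G : Type*} [Field k] [Group G] [Fintype G] [DecidableEq G]

theorem leftMulMatrix_groupRingSum_apply (A : Multiset G) (g h : G) :
    Algebra.leftMulMatrix (MonoidAlgebra.basis G k) (groupRingSum k A) g h =
      A.count (g * h⁻¹) := by
  rw [Algebra.leftMulMatrix_eq_repr_mul, MonoidAlgebra.basis_apply]
  change (groupRingSum k A * single h 1).coeff g = _
  rw [coeff_mul_single_apply, coeff_groupRingSum, mul_one]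

theorem isUnit_det_leftMulMatrix_iff (c : k[G]) :
    IsUnit (Algebra.leftMulMatrix (MonoidAlgebra.basis G k) c).det ↔ IsUnit c := by
  rw [← Matrix.isUnit_iff_isUnit_det, Algebra.leftMulMatrix_apply, LinearMap.isUnit_toMatrix_iff,
    Algebra.lmul_isUnit_iff]

theorem isRoot_charpoly_fromBlocks_leftMulMatrix_iff (a b c d : Subalgebra.center k k[G]) (z : k) :
    letI L := Algebra.leftMulMatrix (MonoidAlgebra.basis G k)
    (Matrix.fromBlocks (L a) (L b) (L c) (L d)).charpoly.IsRoot z ↔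
      ¬ IsUnit ((algebraMap k k[G] z - a) * (algebraMap k k[G] z - d) - b * c) := by
  let L := (Algebra.leftMulMatrix (MonoidAlgebra.basis G k)).comp (Subalgebra.val (.center k k[G]))
  have heval := eval_charpoly_fromBlocks_map L a b c d z
  rw [← isUnit_det_leftMulMatrix_iff, isUnit_iff_ne_zero, not_ne_iff]
  exact Eq.congr_left heval

end RegularRepresentation

section Spectrum

open MonoidAlgebra

variable {G : Type*}

theorem charSum_add (χ : G → ℂ) (A B : Multiset G) :
    charSum χ (A + B) = charSum χ A + charSum χ B := by
  simp only [charSum, Multiset.map_add, Multiset.sum_add]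

theorem charSum_nsmul (χ : G → ℂ) (n : ℕ) (A : Multiset G) :
    charSum χ (n • A) = n • charSum χ A := by
  simp only [charSum, Multiset.map_nsmul, Multiset.sum_nsmul]

variable [Group G] [DecidableEq G] {T11 T22 T12 T21 : Finset G}

theorem charDiff_eq_sub (χ : G → ℂ) : charDiff T11 T22 T12 T21 χ =
    charSum χ (I2 T11 T22 T12 T21) - charSum χ (I3 T11 T22) := by
  rw [charDiff, sub_eq_sub_iff_add_eq_add, ← charSum_add, ← charSum_add,
    add_comm (I2 T11 T22 T12 T21)]
  -- `A - B + B` is the pointwise maximum `A ∪ B` of the multiplicities.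
  exact congrArg (charSum χ) (Multiset.union_comm _ _)

theorem radicand_eq_discrim (hT : IsQuasiAbelian T11 T22 T12 T21) {χ : G → ℂ} (hχ : χ ∈ Irr G) :
    radicand T11 T22 T12 T21 χ = (charSum χ T11.val - charSum χ T22.val) ^ 2 +
      4 * (charSum χ T12.val * charSum χ T21.val) := by
  obtain ⟨h11, h22, h12, -⟩ := hT
  rw [radicand, charDiff_eq_sub]
  simp only [I2, I3, charSum_add, charSum_nsmul, nsmul_eq_mul]
  push_cast
  linear_combination Irr.one_mul_charSum_mulMultiset hχ h11.isClassMultiset T11.val +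
    Irr.one_mul_charSum_mulMultiset hχ h22.isClassMultiset T22.val +
    4 * Irr.one_mul_charSum_mulMultiset hχ h12.isClassMultiset T21.val -
    2 * Irr.one_mul_charSum_mulMultiset hχ h11.isClassMultiset T22.val

variable [Fintype G]

theorem transpose_adjacencyMatrix_graph :
    letI L := Algebra.leftMulMatrix (MonoidAlgebra.basis G ℂ)
    (adjacencyMatrix (graph T11 T22 T12 T21)).transpose =
      Matrix.fromBlocks (L (groupRingSum ℂ T11.val)) (L (groupRingSum ℂ T21.val))
        (L (groupRingSum ℂ T12.val)) (L (groupRingSum ℂ T22.val)) := by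
  ext (g | g) (h | h) <;>
    simp only [adjacencyMatrix, graph, Matrix.transpose_apply, Matrix.of_apply,
      Matrix.fromBlocks_apply₁₁, Matrix.fromBlocks_apply₁₂, Matrix.fromBlocks_apply₂₁,
      Matrix.fromBlocks_apply₂₂, leftMulMatrix_groupRingSum_apply,
      Multiset.count_eq_of_nodup (Finset.nodup _), Finset.mem_val, Nat.cast_ite, Nat.cast_one,
      Nat.cast_zero] <;>
    congr

theorem isRoot_charpoly_graph_iff (hT : IsQuasiAbelian T11 T22 T12 T21) (z : ℂ) :
    (adjacencyMatrix (graph T11 T22 T12 T21)).charpoly.IsRoot z ↔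
      ∃ χ ∈ Irr G, (2 * (χ 1 * z) - charSum χ (I1 T11 T22)) ^ 2 = radicand T11 T22 T12 T21 χ := by
  have hcenter (S : Finset G) (hS : ConjClosed S) :
      groupRingSum ℂ S.val ∈ Subalgebra.center ℂ ℂ[G] :=
    groupRingSum_mem_center_iff.mpr hS.isClassMultiset
  obtain ⟨h11, h22, h12, h21⟩ := id hT
  have hζ : algebraMap ℂ ℂ[G] z ∈ Subalgebra.center ℂ ℂ[G] := Subalgebra.algebraMap_mem _ z
  have hζ11 := sub_mem hζ (hcenter T11 h11)
  rw [← Matrix.charpoly_transpose, transpose_adjacencyMatrix_graph]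
  refine (isRoot_charpoly_fromBlocks_leftMulMatrix_iff ⟨_, hcenter _ h11⟩ ⟨_, hcenter _ h21⟩
    ⟨_, hcenter _ h12⟩ ⟨_, hcenter _ h22⟩ z).trans ?_
  rw [isUnit_iff_forall_irr_linearExtension_ne_zero (sub_mem
    (mul_mem hζ11 (sub_mem hζ (hcenter _ h22))) (mul_mem (hcenter _ h21) (hcenter _ h12)))]
  push Not
  refine exists_congr fun χ => and_congr_right fun hχ => ?_
  have hscalar : linearExtension χ (algebraMap ℂ ℂ[G] z) = χ 1 * z := by
    rw [Algebra.algebraMap_eq_smul_one, map_smul, smul_eq_mul, mul_comm]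
    exact congrArg (· * z) (linearExtension_of χ 1)
  rw [← mul_right_inj' (Irr.one_ne_zero hχ), mul_zero, map_sub, mul_sub,
    Irr.one_mul_linearExtension_mul hχ hζ11, Irr.one_mul_linearExtension_mul hχ (hcenter _ h21),
    radicand_eq_discrim hT hχ, I1, charSum_add]
  simp only [map_sub, hscalar, linearExtension_groupRingSum]
  exact ⟨fun h => by linear_combination 4 * h, fun h => by linear_combination h / 4⟩

end Spectrum

section TraceOfPowers

open Module.End

variable {k V : Type*} [Field k] [AddCommGroup V] [Module k V] {f : Module.End k V}

theorem isSemisimple_of_pow_eq_one {m : ℕ} [NeZero (m : k)] (hf : f ^ m = 1) :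
    f.IsSemisimple :=
  isSemisimple_of_squarefree_aeval_eq_zero (p := Polynomial.X ^ m - 1)
    (Polynomial.X_pow_sub_one_separable_iff.mpr (NeZero.ne _)).squarefree (by simp [hf])

theorem eigenvalue_pow_eq_one {m : ℕ} (hf : f ^ m = 1) {μ : k} (hμ : f.HasEigenvalue μ) :
    μ ^ m = 1 := by
  obtain ⟨v, hv⟩ := hμ.exists_hasEigenvector
  have h : μ ^ m • v = 1 • v := by rw [← hv.pow_apply m, hf, one_apply, one_smul]
  exact smul_left_injective k hv.2 (h.trans (one_smul ℕ v |>.trans (one_smul k v).symm))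

theorem pow_apply_of_mem_eigenspace {μ : k} {v : V} (hv : v ∈ f.eigenspace μ) (t : ℕ) :
    (f ^ t) v = μ ^ t • v := by
  induction t with
  | zero => rw [pow_zero, pow_zero, one_apply, one_smul]
  | succ t ih =>
    rw [pow_succ', pow_succ, mul_apply, ih, map_smul, mem_eigenspace_iff.mp hv, mul_smul]

theorem trace_pow_eq_sum_eigenvalues [IsAlgClosed k] [FiniteDimensional k V]
    (hf : f.IsSemisimple) (t : ℕ) :
    LinearMap.trace k V (f ^ t) =
      ∑ μ : f.Eigenvalues, (Module.finrank k (f.eigenspace μ) : k) * (μ : k) ^ t := by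
  classical
  have hinternal : DirectSum.IsInternal fun μ : f.Eigenvalues => f.eigenspace μ :=
    DirectSum.isInternal_ne_bot_iff.mpr <|
      (DirectSum.isInternal_submodule_iff_iSupIndep_and_iSup_eq_top _).mpr
        ⟨f.eigenspaces_iSupIndep, hf.iSup_eigenspace_eq_top⟩
  have hmaps (μ : k) : Set.MapsTo (f ^ t) (f.eigenspace μ) (f.eigenspace μ) := fun v hv => by
    rw [SetLike.mem_coe, pow_apply_of_mem_eigenspace hv]
    exact Submodule.smul_mem _ _ hv
  have hrestrict (μ : k) : (f ^ t).restrict (hmaps μ) = μ ^ t • LinearMap.id :=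
    LinearMap.ext fun v => Subtype.ext (pow_apply_of_mem_eigenspace v.2 t)
  rw [LinearMap.trace_eq_sum_trace_restrict hinternal fun μ => hmaps μ]
  refine Finset.sum_congr rfl fun μ _ => ?_
  rw [hrestrict, map_smul, LinearMap.trace_id, smul_eq_mul, mul_comm]

end TraceOfPowers

section Cyclotomic

variable {m : ℕ} [NeZero m] {ω : ℂ} (hω : IsPrimitiveRoot ω m)

include hω in
theorem isCyclotomicExtension_adjoin : IsCyclotomicExtension {m} ℚ ℚ⟮ω⟯ := by
  change IsCyclotomicExtension {m} ℚ ℚ⟮ω⟯.toSubalgebra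
  rw [adjoin_simple_toSubalgebra_of_isAlgebraic
    ((hω.isIntegral (NeZero.pos m)).tower_top (A := ℚ)).isAlgebraic]
  exact hω.adjoin_isCyclotomicExtension ℚ

theorem eta_bijective : Function.Bijective (eta hω) := by
  have := isCyclotomicExtension_adjoin hω
  have := IsCyclotomicExtension.isGalois {m} ℚ ℚ⟮ω⟯
  have := IsCyclotomicExtension.finiteDimensional {m} ℚ ℚ⟮ω⟯
  refine (Nat.bijective_iff_injective_and_card _).mpr
    ⟨(isPrimitiveRoot_gen hω).autToPow_injective ℚ, ?_⟩
  rw [IsGalois.card_aut_eq_finrank ℚ ℚ⟮ω⟯, IsCyclotomicExtension.Rat.finrank m ℚ⟮ω⟯,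
    Nat.card_eq_fintype_card, ZMod.card_units_eq_totient]

theorem apply_eq_pow_eta {z : ℚ⟮ω⟯} (hz : z ^ m = 1) (σ : ℚ⟮ω⟯ ≃ₐ[ℚ] ℚ⟮ω⟯) :
    σ z = z ^ (eta hω σ : ZMod m).val := by
  obtain ⟨i, -, rfl⟩ := (isPrimitiveRoot_gen hω).eq_pow_of_pow_eq_one hz
  have hgen : AdjoinSimple.gen ℚ ω ^ (eta hω σ : ZMod m).val = σ (AdjoinSimple.gen ℚ ω) :=
    (isPrimitiveRoot_gen hω).autToPow_spec ℚ σ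
  rw [map_pow, ← hgen, pow_right_comm]

end Cyclotomic

section GaloisAction

variable {G : Type*} [Group G] [Finite G] {ω : ℂ} (hω : IsPrimitiveRoot ω (Monoid.exponent G))
  {χ : G → ℂ}

theorem Irr.exists_forall_apply_pow_eq (hχ : χ ∈ Irr G) (g : G) :
    ∃ y : ℚ⟮ω⟯, (y : ℂ) = χ g ∧ ∀ σ : ℚ⟮ω⟯ ≃ₐ[ℚ] ℚ⟮ω⟯,
      (σ y : ℂ) = χ (g ^ (eta hω σ : ZMod (Monoid.exponent G)).val) := by
  obtain ⟨V, _, _, _, ρ, -, rfl⟩ := hχ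
  let f : Module.End ℂ V := ρ g
  have hone : f ^ Monoid.exponent G = 1 := by
    rw [← map_pow, Monoid.pow_exponent_eq_one, map_one]
  have htrace (t : ℕ) : ρ.character (g ^ t) =
      ∑ μ : f.Eigenvalues, (Module.finrank ℂ (f.eigenspace μ) : ℂ) * (μ : ℂ) ^ t := by
    rw [Representation.character, map_pow]
    exact trace_pow_eq_sum_eigenvalues (isSemisimple_of_pow_eq_one hone) t
  have hroot (μ : f.Eigenvalues) : ∃ z : ℚ⟮ω⟯, (z : ℂ) = μ ∧ z ^ Monoid.exponent G = 1 := by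
    obtain ⟨i, -, hi⟩ := hω.eq_pow_of_pow_eq_one (eigenvalue_pow_eq_one hone μ.2)
    refine ⟨AdjoinSimple.gen ℚ ω ^ i, hi, ?_⟩
    rw [pow_right_comm, (isPrimitiveRoot_gen hω).pow_eq_one, one_pow]
  choose z hz hz1 using hroot
  refine ⟨∑ μ : f.Eigenvalues, (Module.finrank ℂ (f.eigenspace μ) : ℚ⟮ω⟯) * z μ,
    ?_, fun σ => ?_⟩
  · simpa [hz] using (htrace 1).symm
  · simp [htrace, apply_eq_pow_eta hω (hz1 _), hz]

theorem Irr.exists_forall_charSum_powMultiset_eq (hχ : χ ∈ Irr G) (A : Multiset G) :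
    ∃ y : ℚ⟮ω⟯, (y : ℂ) = charSum χ A ∧ ∀ σ : ℚ⟮ω⟯ ≃ₐ[ℚ] ℚ⟮ω⟯,
      (σ y : ℂ) = charSum χ (powMultiset A (eta hω σ)) := by
  choose y hy hσ using Irr.exists_forall_apply_pow_eq hω hχ
  refine ⟨(A.map y).sum, ?_, fun σ => ?_⟩
  · simp [charSum, hy]
  · simp [charSum, powMultiset, map_multiset_sum, hσ]

include hω in
theorem Irr.charSum_mem_adjoin (hχ : χ ∈ Irr G) (A : Multiset G) : charSum χ A ∈ ℚ⟮ω⟯ := by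
  obtain ⟨y, hy, -⟩ := Irr.exists_forall_charSum_powMultiset_eq hω hχ A
  exact hy ▸ y.2

theorem Irr.coe_apply_charSum (hχ : χ ∈ Irr G) (A : Multiset G) (σ : ℚ⟮ω⟯ ≃ₐ[ℚ] ℚ⟮ω⟯) :
    (σ ⟨charSum χ A, Irr.charSum_mem_adjoin hω hχ A⟩ : ℂ) =
      charSum χ (powMultiset A (eta hω σ)) := by
  obtain ⟨y, hy, hσ⟩ := Irr.exists_forall_charSum_powMultiset_eq hω hχ A
  rw [← hσ, ← (Subtype.ext hy : y = ⟨_, Irr.charSum_mem_adjoin hω hχ A⟩)]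

end GaloisAction

section Multisets

variable {α β : Type*} [DecidableEq α]

theorem multiset_map_sub_of_injective [DecidableEq β] {e : α → β} (he : Function.Injective e)
    (A B : Multiset α) : (A - B).map e = A.map e - B.map e := by
  induction B using Multiset.induction_on generalizing A with
  | empty => simp only [Multiset.sub_zero, Multiset.map_zero]
  | cons b B ih => rw [Multiset.sub_cons, ih, Multiset.map_erase _ he, Multiset.map_cons,
      Multiset.sub_cons]

theorem multiset_sub_eq_sub_and_sub_eq_sub_iff {A B A' B' : Multiset α} :
    A' - B' = A - B ∧ B' - A' = B - A ↔ A' + B = A + B' := by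
  simp only [Multiset.ext, ← forall_and, Multiset.count_sub, Multiset.count_add]
  exact forall_congr' fun a => by omega

end Multisets

section Stabilizer

variable {G : Type*} [Group G] [Finite G]

theorem pow_val_injective (t : (ZMod (Monoid.exponent G))ˣ) :
    Function.Injective fun g : G => g ^ (t : ZMod (Monoid.exponent G)).val := by
  refine Function.LeftInverse.injective
    (g := fun g => g ^ ((t⁻¹ : (ZMod (Monoid.exponent G))ˣ) : ZMod (Monoid.exponent G)).val)
    fun g => ?_
  have hmod : (t : ZMod (Monoid.exponent G)).val *
      ((t⁻¹ : (ZMod (Monoid.exponent G))ˣ) : ZMod (Monoid.exponent G)).val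
        ≡ 1 [MOD Monoid.exponent G] := by
    rw [← ZMod.natCast_eq_natCast_iff]
    simp
  simpa [← pow_mul] using pow_eq_pow_iff_modEq.mpr (hmod.of_dvd (Monoid.order_dvd_exponent g))

variable [DecidableEq G] {T11 T22 T12 T21 : Finset G}

theorem mem_stabilizer_iff (t : (ZMod (Monoid.exponent G))ˣ) :
    t ∈ stabilizer T11 T22 T12 T21 ↔ powMultiset (I1 T11 T22) t = I1 T11 T22 ∧
      powMultiset (I2 T11 T22 T12 T21) t + I3 T11 T22 =
        I2 T11 T22 T12 T21 + powMultiset (I3 T11 T22) t := by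
  rw [← multiset_sub_eq_sub_and_sub_eq_sub_iff]
  simp only [powMultiset, ← multiset_map_sub_of_injective (pow_val_injective t)]
  rfl

theorem Irr.charDiff_mem_adjoin {ω : ℂ} (hω : IsPrimitiveRoot ω (Monoid.exponent G))
    {χ : G → ℂ} (hχ : χ ∈ Irr G) : charDiff T11 T22 T12 T21 χ ∈ ℚ⟮ω⟯ :=
  sub_mem (Irr.charSum_mem_adjoin hω hχ _) (Irr.charSum_mem_adjoin hω hχ _)

theorem eta_mem_stabilizer_iff {ω : ℂ} (hω : IsPrimitiveRoot ω (Monoid.exponent G))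
    (hT : IsQuasiAbelian T11 T22 T12 T21) (σ : ℚ⟮ω⟯ ≃ₐ[ℚ] ℚ⟮ω⟯) :
    eta hω σ ∈ stabilizer T11 T22 T12 T21 ↔
      ∀ y : ℚ⟮ω⟯, (y : ℂ) ∈ (fun χ : G → ℂ => charSum χ (I1 T11 T22)) '' Irr G ∪
        charDiff T11 T22 T12 T21 '' Irr G → σ y = y := by
  obtain ⟨h11, h22, h12, h21⟩ := hT
  have hI1 : IsClassMultiset (I1 T11 T22) := h11.isClassMultiset.add h22.isClassMultiset
  have hI2 : IsClassMultiset (I2 T11 T22 T12 T21) :=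
    ((h11.isClassMultiset.mul h11.isClassMultiset).add
      (h22.isClassMultiset.mul h22.isClassMultiset)).add
      ((h12.isClassMultiset.mul h21.isClassMultiset).nsmul 4)
  have hI3 : IsClassMultiset (I3 T11 T22) :=
    (h11.isClassMultiset.mul h22.isClassMultiset).nsmul 2
  rw [mem_stabilizer_iff, (hI1.powMultiset _).eq_iff_forall_irr_charSum_eq hI1,
    ((hI2.powMultiset _).add hI3).eq_iff_forall_irr_charSum_eq (hI2.add (hI3.powMultiset _))]
  have hsum {χ : G → ℂ} (hχ : χ ∈ Irr G) {y : ℚ⟮ω⟯} (hy : charSum χ (I1 T11 T22) = y) :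
      charSum χ (powMultiset (I1 T11 T22) (eta hω σ)) = charSum χ (I1 T11 T22) ↔ σ y = y := by
    rw [(Subtype.ext hy.symm : y = ⟨_, Irr.charSum_mem_adjoin hω hχ _⟩), Subtype.ext_iff,
      Irr.coe_apply_charSum hω hχ]
  have hdiff {χ : G → ℂ} (hχ : χ ∈ Irr G) {y : ℚ⟮ω⟯} (hy : charDiff T11 T22 T12 T21 χ = y) :
      charSum χ (powMultiset (I2 T11 T22 T12 T21) (eta hω σ) + I3 T11 T22) =
        charSum χ (I2 T11 T22 T12 T21 + powMultiset (I3 T11 T22) (eta hω σ)) ↔ σ y = y := by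
    rw [(Subtype.ext (hy.symm.trans (charDiff_eq_sub χ)) :
        y = ⟨_, Irr.charSum_mem_adjoin hω hχ _⟩ - ⟨_, Irr.charSum_mem_adjoin hω hχ _⟩),
      Subtype.ext_iff, map_sub, AddSubgroupClass.coe_sub, AddSubgroupClass.coe_sub,
      Irr.coe_apply_charSum hω hχ, Irr.coe_apply_charSum hω hχ, charSum_add, charSum_add,
      sub_eq_sub_iff_add_eq_add]
  simp only [Set.mem_union, or_imp, forall_and, Set.mem_image, forall_exists_index, and_imp]
  exact and_congr
    ⟨fun h y χ hχ hy => (hsum hχ hy).mp (h χ hχ),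
      fun h χ hχ => (hsum hχ rfl).mpr (h ⟨_, Irr.charSum_mem_adjoin hω hχ _⟩ χ hχ rfl)⟩
    ⟨fun h y χ hχ hy => (hdiff hχ hy).mp (h χ hχ),
      fun h χ hχ => (hdiff hχ rfl).mpr (h ⟨_, Irr.charDiff_mem_adjoin hω hχ⟩ χ hχ rfl)⟩

end Stabilizer

section FixedFields

variable {F E : Type*} [Field F] [Field E] [Algebra F E]

theorem mem_fixingSubgroup_adjoin_iff {S : Set E} {σ : E ≃ₐ[F] E} :
    σ ∈ (adjoin F S).fixingSubgroup ↔ ∀ s ∈ S, σ s = s := by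
  rw [IntermediateField.mem_fixingSubgroup_iff]
  exact forall_mem_adjoin_smul_eq_self_iff F σ

theorem mem_adjoin_iff_forall_apply_eq [hgal : IsGalois F E] {S : Set E} {x : E} :
    x ∈ adjoin F S ↔ ∀ σ : E ≃ₐ[F] E, (∀ s ∈ S, σ s = s) → σ x = x := by
  simp only [← mem_fixingSubgroup_adjoin_iff, ← mem_fixedField_iff,
    InfiniteGalois.fixedField_fixingSubgroup]

theorem finrank_adjoin_mul_card_fixing [hfin : FiniteDimensional F E] [hgal : IsGalois F E]
    (S : Set E) :
    Module.finrank F (adjoin F S) * Nat.card {σ : E ≃ₐ[F] E // ∀ s ∈ S, σ s = s} =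
      Module.finrank F E := by
  simp only [← mem_fixingSubgroup_adjoin_iff]
  rw [← Module.finrank_mul_finrank F (adjoin F S) E]
  exact congrArg _ (IsGalois.card_fixingSubgroup_eq_finrank (adjoin F S))

theorem lift_adjoin_preimage {L : IntermediateField F E} {S : Set E} (hS : S ⊆ L) :
    lift (adjoin F {y : L | (y : E) ∈ S}) = adjoin F S := by
  rw [lift_adjoin]
  exact congrArg _ (Set.image_preimage_eq_of_subset (by simpa using hS))

end FixedFields

section BaseField

variable {G : Type*} [Group G] [Finite G] [DecidableEq G] {T11 T22 T12 T21 : Finset G} {ω : ℂ}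

theorem baseField_eq_lift_adjoin (hω : IsPrimitiveRoot ω (Monoid.exponent G)) :
    baseField T11 T22 T12 T21 = lift (adjoin ℚ {y : ℚ⟮ω⟯ |
      (y : ℂ) ∈ (fun χ : G → ℂ => charSum χ (I1 T11 T22)) '' Irr G ∪
        charDiff T11 T22 T12 T21 '' Irr G}) := by
  refine (lift_adjoin_preimage ?_).symm
  rintro _ (⟨χ, hχ, rfl⟩ | ⟨χ, hχ, rfl⟩)
  exacts [Irr.charSum_mem_adjoin hω hχ _, Irr.charDiff_mem_adjoin hω hχ]

theorem coe_baseField_eq (hω : IsPrimitiveRoot ω (Monoid.exponent G))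
    (hT : IsQuasiAbelian T11 T22 T12 T21) :
    (baseField T11 T22 T12 T21 : Set ℂ) =
      {x : ℂ | ∃ y : ℚ⟮ω⟯, (y : ℂ) = x ∧
        ∀ σ : ℚ⟮ω⟯ ≃ₐ[ℚ] ℚ⟮ω⟯, eta hω σ ∈ stabilizer T11 T22 T12 T21 → σ y = y} := by
  have := isCyclotomicExtension_adjoin hω
  have hgal : IsGalois ℚ ℚ⟮ω⟯ := IsCyclotomicExtension.isGalois {Monoid.exponent G} ℚ ℚ⟮ω⟯
  -- `lift` and `IsCyclotomicExtension` put syntactically different `ℚ`-algebra structures on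
  -- `ℚ⟮ω⟯`, so instance search does not find `hgal`.
  ext x
  simp only [eta_mem_stabilizer_iff hω hT, baseField_eq_lift_adjoin hω, SetLike.mem_coe,
    Set.mem_ofPred_eq]
  constructor
  · intro hx
    have hxω : x ∈ ℚ⟮ω⟯ := lift_le _ hx
    exact ⟨⟨x, hxω⟩, rfl, (mem_adjoin_iff_forall_apply_eq (hgal := hgal)).mp
      ((mem_lift ⟨x, hxω⟩).mp hx)⟩
  · rintro ⟨y, rfl, hy⟩
    exact (mem_lift y).mpr ((mem_adjoin_iff_forall_apply_eq (hgal := hgal)).mpr hy)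

theorem finrank_baseField_mul_card_stabilizer (hω : IsPrimitiveRoot ω (Monoid.exponent G))
    (hT : IsQuasiAbelian T11 T22 T12 T21) :
    Module.finrank ℚ (baseField T11 T22 T12 T21) * Nat.card (stabilizer T11 T22 T12 T21) =
      Nat.totient (Monoid.exponent G) := by
  have := isCyclotomicExtension_adjoin hω
  have hgal : IsGalois ℚ ℚ⟮ω⟯ := IsCyclotomicExtension.isGalois {Monoid.exponent G} ℚ ℚ⟮ω⟯
  have hfin : FiniteDimensional ℚ ℚ⟮ω⟯ :=
    IsCyclotomicExtension.finiteDimensional {Monoid.exponent G} ℚ ℚ⟮ω⟯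
  rw [← IsCyclotomicExtension.Rat.finrank (Monoid.exponent G) ℚ⟮ω⟯, baseField_eq_lift_adjoin hω,
    ← (liftAlgEquiv _).toLinearEquiv.finrank_eq,
    ← Nat.card_congr ((Equiv.ofBijective _ (eta_bijective hω)).subtypeEquiv
      (q := (· ∈ stabilizer T11 T22 T12 T21)) fun σ => (eta_mem_stabilizer_iff hω hT σ).symm)]
  exact finrank_adjoin_mul_card_fixing (hfin := hfin) (hgal := hgal) _

end BaseField

section Kummer

variable {K E : Type*} [Field K] [Field E] [Algebra K E]

theorem isGalois_of_adjoin_eq_top {S : Set E} (hS : adjoin K S = ⊤)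
    (hsep : ∀ x ∈ S, IsSeparable K x)
    (hsplit : ∀ x ∈ S, ((minpoly K x).map (algebraMap K E)).Splits) : IsGalois K E := by
  have hsepE : Algebra.IsSeparable K E := by
    rw [← separableClosure.eq_top_iff, eq_top_iff, ← hS, adjoin_le_iff]
    exact fun x hx => mem_separableClosure_iff.mpr (hsep x hx)
  have hnormal : Normal K E := normal_iff.mpr fun x =>
    ⟨Algebra.IsSeparable.isIntegral K x, splits_of_mem_adjoin K E
      (fun y hy => ⟨(hsep y hy).isIntegral, hsplit y hy⟩) (hS ▸ mem_top : x ∈ adjoin K S)⟩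
  exact {}

theorem minpoly_dvd_X_sq_sub_C {x : E} {c : K} (hx : x ^ 2 = algebraMap K E c) :
    minpoly K x ∣ Polynomial.X ^ 2 - Polynomial.C c :=
  minpoly.dvd K x (by simp [hx])

theorem isSeparable_of_sq_eq_algebraMap [NeZero (2 : K)] {x : E} {c : K}
    (hx : x ^ 2 = algebraMap K E c) : IsSeparable K x := by
  rcases eq_or_ne c 0 with rfl | hc
  · rw [map_zero, sq_eq_zero_iff] at hx
    exact hx ▸ map_zero (algebraMap K E) ▸ isSeparable_algebraMap (0 : K)
  · exact (Polynomial.separable_X_pow_sub_C c (by exact_mod_cast two_ne_zero) hc).of_dvd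
      (minpoly_dvd_X_sq_sub_C hx)

theorem splits_minpoly_of_sq_eq_algebraMap {x : E} {c : K} (hx : x ^ 2 = algebraMap K E c) :
    ((minpoly K x).map (algebraMap K E)).Splits := by
  have hfac : (Polynomial.X ^ 2 - Polynomial.C c).map (algebraMap K E) =
      (Polynomial.X - Polynomial.C x) * (Polynomial.X - Polynomial.C (-x)) := by
    simp only [Polynomial.map_sub, Polynomial.map_pow, Polynomial.map_X, Polynomial.map_C, ← hx,
      Polynomial.C_neg, Polynomial.C_pow]
    ring
  have hdvd := Polynomial.map_dvd (algebraMap K E) (minpoly_dvd_X_sq_sub_C hx)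
  rw [hfac] at hdvd
  exact ((Polynomial.Splits.X_sub_C x).mul (Polynomial.Splits.X_sub_C (-x))).of_dvd
    (mul_ne_zero (Polynomial.X_sub_C_ne_zero _) (Polynomial.X_sub_C_ne_zero _)) hdvd

/-- The character `σ ↦ σ x / x` of the Galois group attached to a common eigenvector `x` of its
elements. The characters of eigenvectors with ratio outside `K` are distinct, so Dedekind's theorem
applies to them. -/
noncomputable def eigencharacter {x : E} (hx0 : x ≠ 0)
    (hx : ∀ σ : E ≃ₐ[K] E, ∃ c : K, σ x = c • x) : (E ≃ₐ[K] E) →* E where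
  toFun σ := σ x / x
  map_one' := div_self hx0
  map_mul' σ τ := by
    obtain ⟨c, hc⟩ := hx τ
    rw [AlgEquiv.mul_apply, hc, map_smul, smul_div_assoc, smul_div_assoc, div_self hx0,
      mul_smul_comm, mul_one]

theorem linearIndependent_of_eigenvectors [IsGalois K E] {ι : Type*} {s : ι → E}
    (hs0 : ∀ i, s i ≠ 0) (hs : ∀ i (σ : E ≃ₐ[K] E), ∃ c : K, σ (s i) = c • s i)
    (hratio : ∀ i j (c : K), s i = c • s j → i = j) : LinearIndependent K s := by
  have hinj : Function.Injective fun i => eigencharacter (hs0 i) (hs i) := by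
    intro i j hij
    have hfix (σ : E ≃ₐ[K] E) : σ (s i / s j) = s i / s j := by
      have h : σ (s i) / s i = σ (s j) / s j := DFunLike.congr_fun hij σ
      rw [map_div₀, div_eq_div_iff (by simpa using hs0 j) (hs0 j), mul_comm (s i)]
      exact (div_eq_div_iff (hs0 i) (hs0 j)).mp h
    obtain ⟨c, hc⟩ := (InfiniteGalois.mem_range_algebraMap_iff_fixed _).mpr hfix
    exact hratio i j c (by rw [Algebra.smul_def, hc, div_mul_cancel₀ _ (hs0 j)])
  have hdedekind := (linearIndependent_monoidHom (E ≃ₐ[K] E) E).comp _ hinj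
  rw [linearIndependent_iff'] at hdedekind ⊢
  intro t c hc i hi
  have hzero := hdedekind t (fun j => algebraMap K E (c j) * s j) (funext fun σ => ?_) i hi
  · simpa [hs0] using hzero
  · have h := congrArg σ hc
    simp only [map_sum, map_smul, map_zero] at h
    rw [Finset.sum_apply, Pi.zero_apply, ← h]
    refine Finset.sum_congr rfl fun j _ => ?_
    change algebraMap K E (c j) * s j * (σ (s j) / s j) = _
    rw [mul_assoc, mul_div_cancel₀ _ (hs0 j), Algebra.smul_def]

/-- `x` is a square root of a nonzero element of `K` whose class in `K^× / K^{×2}` is `q`. Such an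
`x` is determined by `q` up to a factor in `K`. -/
def HasSquareClass (x : E) (q : Kˣ ⧸ (powMonoidHom 2 : Kˣ →* Kˣ).range) : Prop :=
  ∃ u : Kˣ, x ^ 2 = algebraMap K E u ∧ QuotientGroup.mk u = q

namespace HasSquareClass

variable {x y : E} {p q : Kˣ ⧸ (powMonoidHom 2 : Kˣ →* Kˣ).range}

theorem one : HasSquareClass (1 : E) (1 : Kˣ ⧸ (powMonoidHom 2 : Kˣ →* Kˣ).range) :=
  ⟨1, by simp, rfl⟩

theorem mul (hx : HasSquareClass x p) (hy : HasSquareClass y q) :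
    HasSquareClass (x * y) (p * q) := by
  obtain ⟨u, hu, rfl⟩ := hx
  obtain ⟨v, hv, rfl⟩ := hy
  exact ⟨u * v, by rw [mul_pow, hu, hv, Units.val_mul, map_mul], rfl⟩

theorem inv (hx : HasSquareClass x p) : HasSquareClass x⁻¹ p⁻¹ := by
  obtain ⟨u, hu, rfl⟩ := hx
  exact ⟨u⁻¹, by rw [inv_pow, hu, Units.val_inv_eq_inv_val, map_inv₀], rfl⟩

theorem ne_zero (hx : HasSquareClass x p) : x ≠ 0 := by
  obtain ⟨u, hu, -⟩ := hx
  rintro rfl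
  exact u.ne_zero ((map_eq_zero (algebraMap K E)).mp (by rw [← hu, zero_pow two_ne_zero]))

theorem eq_one_iff (hx : HasSquareClass x p) : p = 1 ↔ ∃ c : K, x = algebraMap K E c := by
  obtain ⟨u, hu, rfl⟩ := hx
  rw [QuotientGroup.eq_one_iff]
  constructor
  · rintro ⟨c, rfl⟩
    have hsq : x ^ 2 = algebraMap K E c ^ 2 := by simpa using hu
    rcases sq_eq_sq_iff_eq_or_eq_neg.mp hsq with h | h
    · exact ⟨c, h⟩
    · exact ⟨-c, by rw [h, map_neg]⟩
  · rintro ⟨c, rfl⟩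
    have hc : c ^ 2 = u := (algebraMap K E).injective (by rw [map_pow, hu])
    have hc0 : c ≠ 0 := by
      rintro rfl
      exact u.ne_zero (by rw [← hc, zero_pow two_ne_zero])
    exact ⟨Units.mk0 c hc0, Units.ext hc⟩

theorem eq_iff (hx : HasSquareClass x p) (hy : HasSquareClass y q) :
    p = q ↔ ∃ c : K, x = c • y := by
  rw [← mul_inv_eq_one, (hx.mul hy.inv).eq_one_iff]
  exact exists_congr fun c => by
    rw [Algebra.smul_def, ← div_eq_mul_inv, div_eq_iff hy.ne_zero]

theorem exists_apply_eq_smul (hx : HasSquareClass x p) (σ : E ≃ₐ[K] E) :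
    ∃ c : K, σ x = c • x := by
  refine (HasSquareClass.eq_iff (p := p) ?_ hx).mp rfl
  obtain ⟨u, hu, hp⟩ := hx
  exact ⟨u, by rw [← map_pow, hu, AlgEquiv.commutes], hp⟩

end HasSquareClass

/-- The subgroup of `K^× / K^{×2}` generated by the classes of the squares of the nonzero elements
of `S`: the counterpart of `squareClassGroup` for an arbitrary extension, with a set of square roots
in place of a set of radicands. Elements of `S` whose square is not in `K` do not contribute. -/
def squareClasses (K : Type*) [Field K] [Algebra K E] (S : Set E) :
    Subgroup (Kˣ ⧸ (powMonoidHom 2 : Kˣ →* Kˣ).range) :=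
  Subgroup.closure {q | ∃ x ∈ S, HasSquareClass x q}

variable {S : Set E}

theorem exists_hasSquareClass {q : Kˣ ⧸ (powMonoidHom 2 : Kˣ →* Kˣ).range}
    (hq : q ∈ squareClasses K S) : ∃ x : E, HasSquareClass x q := by
  induction hq using Subgroup.closure_induction with
  | mem q hq => exact hq.imp fun x hx => hx.2
  | one => exact ⟨1, .one⟩
  | mul p q _ _ hp hq =>
    obtain ⟨x, hx⟩ := hp
    obtain ⟨y, hy⟩ := hq
    exact ⟨x * y, hx.mul hy⟩
  | inv q _ hq =>
    obtain ⟨x, hx⟩ := hq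
    exact ⟨x⁻¹, hx.inv⟩

theorem eq_zero_or_hasSquareClass_of_mem_closure (hS : ∀ x ∈ S, ∃ c : K, x ^ 2 = algebraMap K E c)
    {x : E} (hx : x ∈ Submonoid.closure S) :
    x = 0 ∨ ∃ q ∈ squareClasses K S, HasSquareClass x q := by
  induction hx using Submonoid.closure_induction with
  | mem x hx =>
    refine or_iff_not_imp_left.mpr fun hx0 => ?_
    obtain ⟨c, hc⟩ := hS x hx
    have hc0 : c ≠ 0 := by
      rintro rfl
      exact hx0 (by simpa using hc)
    have hclass : HasSquareClass x (QuotientGroup.mk (Units.mk0 c hc0)) := ⟨_, hc, rfl⟩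
    exact ⟨_, Subgroup.subset_closure ⟨x, hx, hclass⟩, hclass⟩
  | one => exact Or.inr ⟨1, one_mem _, .one⟩
  | mul x y _ _ hx hy =>
    rcases hx with rfl | ⟨p, hp, hx⟩
    · exact Or.inl (zero_mul y)
    rcases hy with rfl | ⟨q, hq, hy⟩
    · exact Or.inl (mul_zero x)
    · exact Or.inr ⟨p * q, mul_mem hp hq, hx.mul hy⟩

theorem span_range_eq_top_of_hasSquareClass (hS : ∀ x ∈ S, ∃ c : K, x ^ 2 = algebraMap K E c)
    (htop : adjoin K S = ⊤) {s : squareClasses K S → E}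
    (hs : ∀ q : squareClasses K S, HasSquareClass (s q) (q : Kˣ ⧸ (powMonoidHom 2).range)) :
    Submodule.span K (Set.range s) = ⊤ := by
  have halg : ∀ x ∈ S, IsAlgebraic K x := fun x hx => by
    obtain ⟨c, hc⟩ := hS x hx
    exact (IsIntegral.of_pow two_pos (hc ▸ isIntegral_algebraMap)).isAlgebraic
  have hadjoin : Algebra.adjoin K S = ⊤ := by
    rw [← adjoin_toSubalgebra_of_isAlgebraic halg, htop, top_toSubalgebra]
  rw [eq_top_iff, ← Algebra.top_toSubmodule, ← hadjoin, Algebra.adjoin_eq_span, Submodule.span_le]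
  intro x hx
  rcases eq_zero_or_hasSquareClass_of_mem_closure hS hx with rfl | ⟨q, hq, hxq⟩
  · exact zero_mem _
  · obtain ⟨c, hc⟩ := (hxq.eq_iff (hs ⟨q, hq⟩)).mp rfl
    exact hc ▸ Submodule.smul_mem _ c (Submodule.subset_span ⟨⟨q, hq⟩, rfl⟩)

theorem finrank_eq_card_squareClasses [NeZero (2 : K)]
    (hS : ∀ x ∈ S, ∃ c : K, x ^ 2 = algebraMap K E c) (htop : adjoin K S = ⊤) :
    Module.finrank K E = Nat.card (squareClasses K S) := by
  have : IsGalois K E := isGalois_of_adjoin_eq_top htop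
    (fun x hx => (hS x hx).elim fun _ => isSeparable_of_sq_eq_algebraMap)
    (fun x hx => (hS x hx).elim fun _ => splits_minpoly_of_sq_eq_algebraMap)
  choose s hs using fun q : squareClasses K S => exists_hasSquareClass q.2
  have hlin : LinearIndependent K s :=
    linearIndependent_of_eigenvectors (fun q => (hs q).ne_zero)
      (fun q => (hs q).exists_apply_eq_smul)
      fun p q c h => Subtype.ext (((hs p).eq_iff (hs q)).mpr ⟨c, h⟩)
  exact Module.finrank_eq_nat_card_basis
    (Module.Basis.mk hlin (span_range_eq_top_of_hasSquareClass hS htop hs).ge)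

theorem finrank_adjoin_eq_card_squareClassGroup (K : IntermediateField ℚ ℂ) {S : Set ℂ}
    (hS : ∀ x ∈ S, x ^ 2 ∈ K) :
    Module.finrank K (adjoin K S) = Nat.card (squareClassGroup K ((fun x => x ^ 2) '' S)) := by
  have htop : adjoin K {y : adjoin K S | (y : ℂ) ∈ S} = ⊤ :=
    lift_injective _ ((lift_adjoin_preimage (subset_adjoin K S)).trans (lift_top K _).symm)
  rw [finrank_eq_card_squareClasses (fun y hy => ⟨⟨_, hS y hy⟩, Subtype.ext rfl⟩) htop,
    squareClassGroup, squareClasses]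
  refine congrArg (fun Q => Nat.card (Subgroup.closure Q)) (Set.ext fun q => ⟨?_, ?_⟩)
  · rintro ⟨y, hy, u, hu, rfl⟩
    exact ⟨u, ⟨y, hy, congrArg Subtype.val hu⟩, rfl⟩
  · rintro ⟨u, ⟨x, hx, hu⟩, rfl⟩
    exact ⟨⟨x, subset_adjoin K S hx⟩, hx, u, Subtype.ext hu, rfl⟩

end Kummer

section SplittingField

variable {G : Type*} [Group G]

theorem Irr.one_mem {χ : G → ℂ} (hχ : χ ∈ Irr G) (K : IntermediateField ℚ ℂ) : χ 1 ∈ K := by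
  obtain ⟨d, -, h⟩ := Irr.exists_natCast_eq_one hχ
  exact h ▸ _root_.natCast_mem K d

variable [DecidableEq G] {T11 T22 T12 T21 : Finset G}

theorem radicand_mem_baseField {χ : G → ℂ} (hχ : χ ∈ Irr G) :
    radicand T11 T22 T12 T21 χ ∈ baseField T11 T22 T12 T21 :=
  mul_mem (Irr.one_mem hχ _) (subset_adjoin _ _ (Or.inr ⟨χ, hχ, rfl⟩))

variable [Fintype G] {r : (G → ℂ) → ℂ}

theorem isRoot_charpoly_graph_of_sq_eq_radicand (hT : IsQuasiAbelian T11 T22 T12 T21) {χ : G → ℂ}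
    (hχ : χ ∈ Irr G) {s : ℂ} (hs : s ^ 2 = radicand T11 T22 T12 T21 χ) :
    (adjacencyMatrix (graph T11 T22 T12 T21)).charpoly.IsRoot
      ((charSum χ (I1 T11 T22) + s) / (2 * χ 1)) := by
  refine (isRoot_charpoly_graph_iff hT _).mpr ⟨χ, hχ, ?_⟩
  have hχ1 := Irr.one_ne_zero hχ
  rw [← hs, ← mul_assoc, mul_div_cancel₀ _ (mul_ne_zero two_ne_zero hχ1), add_sub_cancel_left]

theorem exists_eq_div_of_isRoot_charpoly_graph (hT : IsQuasiAbelian T11 T22 T12 T21) {z : ℂ}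
    (hz : (adjacencyMatrix (graph T11 T22 T12 T21)).charpoly.IsRoot z) :
    ∃ χ ∈ Irr G, ∃ s : ℂ, s ^ 2 = radicand T11 T22 T12 T21 χ ∧
      z = (charSum χ (I1 T11 T22) + s) / (2 * χ 1) := by
  obtain ⟨χ, hχ, h⟩ := (isRoot_charpoly_graph_iff hT z).mp hz
  have hχ1 := Irr.one_ne_zero hχ
  exact ⟨χ, hχ, _, h, by field_simp; ring⟩

theorem splittingField_eq_adjoin (hT : IsQuasiAbelian T11 T22 T12 T21)
    (hr : ∀ χ ∈ Irr G, r χ ^ 2 = radicand T11 T22 T12 T21 χ) :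
    splittingField (graph T11 T22 T12 T21) =
      adjoin ℚ ((fun χ : G → ℂ => charSum χ (I1 T11 T22)) '' Irr G ∪ r '' Irr G) := by
  refine le_antisymm (adjoin_le_iff.mpr fun z hz => ?_) (adjoin_le_iff.mpr ?_)
  · obtain ⟨χ, hχ, s, hs, rfl⟩ := exists_eq_div_of_isRoot_charpoly_graph hT hz
    refine div_mem (add_mem (subset_adjoin _ _ (Or.inl ⟨χ, hχ, rfl⟩)) ?_)
      (mul_mem (ofNat_mem _ 2) (Irr.one_mem hχ _))
    have hmem : r χ ∈ adjoin ℚ ((fun χ : G → ℂ => charSum χ (I1 T11 T22)) '' Irr G ∪ r '' Irr G) :=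
      subset_adjoin _ _ (Or.inr ⟨χ, hχ, rfl⟩)
    rcases sq_eq_sq_iff_eq_or_eq_neg.mp (hs.trans (hr χ hχ).symm) with rfl | rfl
    exacts [hmem, neg_mem hmem]
  · have hroot {χ : G → ℂ} (hχ : χ ∈ Irr G) {s : ℂ} (hs : s ^ 2 = radicand T11 T22 T12 T21 χ) :
        (charSum χ (I1 T11 T22) + s) / (2 * χ 1) ∈ splittingField (graph T11 T22 T12 T21) :=
      subset_adjoin _ _ (isRoot_charpoly_graph_of_sq_eq_radicand hT hχ hs)
    have hplus {χ : G → ℂ} (hχ : χ ∈ Irr G) := hroot hχ (hr χ hχ)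
    have hminus {χ : G → ℂ} (hχ : χ ∈ Irr G) := hroot hχ ((neg_sq _).trans (hr χ hχ))
    rintro _ (⟨χ, hχ, rfl⟩ | ⟨χ, hχ, rfl⟩) <;> have hχ1 := Irr.one_ne_zero hχ
    · rw [SetLike.mem_coe]
      convert mul_mem (Irr.one_mem hχ _) (add_mem (hplus hχ) (hminus hχ)) using 1
      field_simp
      ring
    · rw [SetLike.mem_coe]
      convert mul_mem (Irr.one_mem hχ _) (sub_mem (hplus hχ) (hminus hχ)) using 1
      field_simp
      ring

theorem splittingField_eq_restrictScalars (hT : IsQuasiAbelian T11 T22 T12 T21)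
    (hr : ∀ χ ∈ Irr G, r χ ^ 2 = radicand T11 T22 T12 T21 χ) :
    splittingField (graph T11 T22 T12 T21) =
      (adjoin (baseField T11 T22 T12 T21) (r '' Irr G)).restrictScalars ℚ := by
  refine (splittingField_eq_adjoin hT hr).trans (Eq.trans ?_ (adjoin_adjoin_left ℚ _ _).symm)
  refine le_antisymm (adjoin.mono _ _ _ (Set.union_subset_union_left _ Set.subset_union_left))
    (adjoin_le_iff.mpr ?_)
  rintro _ ((⟨χ, hχ, rfl⟩ | ⟨χ, hχ, rfl⟩) | ⟨χ, hχ, rfl⟩)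
  · exact subset_adjoin _ _ (Or.inl ⟨χ, hχ, rfl⟩)
  · have hdiff : charDiff T11 T22 T12 T21 χ = r χ ^ 2 / χ 1 := by
      rw [hr χ hχ, radicand, mul_div_cancel_left₀ _ (Irr.one_ne_zero hχ)]
    rw [hdiff]
    exact div_mem (_root_.pow_mem (subset_adjoin _ _ (Or.inr ⟨χ, hχ, rfl⟩) : r χ ∈ _) 2)
      (Irr.one_mem hχ _)
  · exact subset_adjoin _ _ (Or.inr ⟨χ, hχ, rfl⟩)

theorem finrank_splittingField (hT : IsQuasiAbelian T11 T22 T12 T21)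
    (hr : ∀ χ ∈ Irr G, r χ ^ 2 = radicand T11 T22 T12 T21 χ) :
    algebraicDegree (graph T11 T22 T12 T21) =
      Module.finrank ℚ (baseField T11 T22 T12 T21) *
        Nat.card (squareClassGroup (baseField T11 T22 T12 T21)
          (radicand T11 T22 T12 T21 '' Irr G)) := by
  have hsq : radicand T11 T22 T12 T21 '' Irr G = (fun x => x ^ 2) '' (r '' Irr G) := by
    rw [Set.image_image]
    exact Set.image_congr fun χ hχ => (hr χ hχ).symm
  have hmem : ∀ x ∈ r '' Irr G, x ^ 2 ∈ baseField T11 T22 T12 T21 := by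
    rintro _ ⟨χ, hχ, rfl⟩
    exact hr χ hχ ▸ radicand_mem_baseField hχ
  rw [algebraicDegree, splittingField_eq_restrictScalars hT hr, hsq,
    ← finrank_adjoin_eq_card_squareClassGroup _ hmem]
  exact (Module.finrank_mul_finrank ℚ (baseField T11 T22 T12 T21)
    (adjoin (baseField T11 T22 T12 T21) (r '' Irr G))).symm

end SplittingField

end SemiCayley

open SemiCayley IntermediateField in
theorem mainTheorem1 {G : Type*} [Group G] [Fintype G] [DecidableEq G]
    (T11 T22 T12 T21 : Finset G) (hT : IsQuasiAbelian T11 T22 T12 T21)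
    (ω : ℂ) (hω : IsPrimitiveRoot ω (Monoid.exponent G))
    (r : (G → ℂ) → ℂ) (hr : ∀ χ ∈ Irr G, r χ ^ 2 = radicand T11 T22 T12 T21 χ) :
    splittingField (graph T11 T22 T12 T21) =
        adjoin ℚ ((fun χ : G → ℂ => charSum χ (I1 T11 T22)) '' Irr G ∪ r '' Irr G) ∧
      splittingField (graph T11 T22 T12 T21) =
        (adjoin (baseField T11 T22 T12 T21) (r '' Irr G)).restrictScalars ℚ ∧
      (baseField T11 T22 T12 T21 : Set ℂ) =
        {x : ℂ | ∃ y : ℚ⟮ω⟯, (y : ℂ) = x ∧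
          ∀ σ : ℚ⟮ω⟯ ≃ₐ[ℚ] ℚ⟮ω⟯, eta hω σ ∈ stabilizer T11 T22 T12 T21 → σ y = y} ∧
      (∀ χ ∈ Irr G, radicand T11 T22 T12 T21 χ ∈ baseField T11 T22 T12 T21) ∧
      (algebraicDegree (graph T11 T22 T12 T21) : ℚ) =
        (Nat.totient (Monoid.exponent G) : ℚ) *
          Nat.card (squareClassGroup (baseField T11 T22 T12 T21)
            (radicand T11 T22 T12 T21 '' Irr G)) /
          Nat.card (stabilizer T11 T22 T12 T21) := by
  refine ⟨splittingField_eq_adjoin hT hr, splittingField_eq_restrictScalars hT hr,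
    coe_baseField_eq hω hT, fun χ hχ => radicand_mem_baseField hχ, ?_⟩
  have hcard := finrank_baseField_mul_card_stabilizer hω hT
  have hne : (Nat.card (stabilizer T11 T22 T12 T21) : ℚ) ≠ 0 := by
    intro h0
    rw [Nat.cast_eq_zero.mp h0, mul_zero] at hcard
    exact (Nat.totient_pos.mpr (NeZero.pos (Monoid.exponent G))).ne hcard
  rw [finrank_splittingField hT hr, ← hcard]
  push_cast
  field_simp
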